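/- Let $(d_1,d_2,\dots,d_q)$, $q\ge 1$, be a non-increasing sequence of positive integers. A finite simple graph $H$ is called a \emph{$(d_1,d_2,\dots,d_q)$-tree} if $H=H_q$ for graphs $H_1,\dots,H_q$ such that $H_1$ is a complete graph $\mathcal{K}_{d_1}$ and, for $2\le i\le q$, $H_i$ is the union $H_{i-1}\cup_{\mathcal{K}_{d_i-1}}\mathcal{K}_{d_i}$ of $H_{i-1}$ and a complete graph on $d_i$ vertices glued along a complete subgraph on $d_i-1$ vertices (for $d_i=1$, $H_i$ is the disjoint union of $H_{i-1}$ and an isolated vertex). Let $\mathbb{K}$ be a field, let $G$ be a finite simple graph with vertices $x_1,\dots,x_n$, and let $R=\mathbb{K}[x_1,\dots,x_n]$. Let $\Delta_G$ be the independence complex of $G$, i.e. the simplicial complex of all independent sets of $G$, and let $\mathbb{K}[\Delta_G]=R/I_{\Delta_G}$ be its Stanley--Reisner ring, where $I_{\Delta_G}$ is generated by the monomials $\prod_{x_i\in F}x_i$ with $F\subseteq\{x_1,\dots,x_n\}$, $F\notin\Delta_G$. (So $I_{\Delta_G}$ is the edge ideal of $G$.) \textbf{Theorem.} If $G$ is connected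 and its complement $\overline{G}$ is a $(d_1,d_2,\dots,d_q)$-tree, then the projective dimension of $\mathbb{K}[\Delta_G]$ as an $R$-module is $$\operatorname{pdim}\mathbb{K}[\Delta_G]=\max_{1\le i\le n}\deg_G(x_i).$$ -/

import Mathlib

universe u v

/-- The independence complex `Δ_G` of a graph: its faces are the (nonempty) finite independent
sets of `G`. (Mathlib's simplicial complexes leave the empty face implicit.) -/
def independenceComplex {V : Type u} (G : SimpleGraph V) : AbstractSimplicialComplex V where
  faces := {F | F.Nonempty ∧ G.IsIndepSet (F : Set V)}
  isRelLowerSet_faces := by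
    rintro F ⟨hne, hF⟩
    exact ⟨hne, fun E hE hEne => ⟨hEne, Set.Pairwise.mono (Finset.coe_subset.mpr hE) hF⟩⟩
  singleton_mem x := by
    refine ⟨Finset.singleton_nonempty x, ?_⟩
    rw [Finset.coe_singleton]
    exact Set.pairwise_singleton _ _

/-- The Stanley–Reisner ideal `I_Δ` in `K[x | x ∈ V]`, generated by the squarefree monomials
`x_F = ∏_{x ∈ F} x` of the nonfaces `F` of `Δ`. The empty set always counts as a face, hence
only nonempty `F` occur. -/
noncomputable def stanleyReisnerIdeal (K : Type v) [Field K] {V : Type u} (Δ : AbstractSimplicialComplex V) :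
    Ideal (MvPolynomial V K) :=
  Ideal.span {m | ∃ F : Finset V, F.Nonempty ∧ F ∉ Δ.faces ∧ m = ∏ x ∈ F, MvPolynomial.X x}

/-- The Stanley–Reisner ring `K[Δ] = R / I_Δ`, where `R = K[x | x ∈ V]`. -/
abbrev StanleyReisnerRing (K : Type v) [Field K] {V : Type u} (Δ : AbstractSimplicialComplex V) :
    Type (max u v) :=
  MvPolynomial V K ⧸ stanleyReisnerIdeal K Δ

/-- The complete graph on the vertices of `T` (all other elements of `V` are isolated). -/
def completeOn {V : Type u} (T : Finset V) : SimpleGraph V where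
  Adj a b := a ≠ b ∧ a ∈ T ∧ b ∈ T
  symm := ⟨fun _ _ h => ⟨h.1.symm, h.2.2, h.2.1⟩⟩
  loopless := ⟨fun _ h => h.1 rfl⟩

/-- `GluedCliques d S H`: the graph with vertex set `S` and the edges of `H` is obtained from the
complete graph `K_{d_1}` by successively gluing on complete graphs `K_{d_i}`, where `K_{d_i}` meets
the graph constructed so far precisely in a complete subgraph `K_{d_i - 1}` of it. -/
inductive GluedCliques {V : Type u} [DecidableEq V] :
    List ℕ → Finset V → SimpleGraph V → Prop
  | base (T : Finset V) : GluedCliques [T.card] T (completeOn T)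
  | glue (d : List ℕ) (S : Finset V) (H : SimpleGraph V) (T : Finset V)
      (hH : GluedCliques d S H)
      (hclique : H.IsClique ((S ∩ T : Finset V) : Set V))
      (hcard : (S ∩ T).card + 1 = T.card) :
      GluedCliques (d ++ [T.card]) (S ∪ T) (H ⊔ completeOn T)

/-- `H` is a `(d_1, …, d_q)`-tree: the sequence `d = [d_1, …, d_q]` consists of positive integers
and is non-increasing, and `H` (with all of `V` as its vertex set) arises from `K_{d_1}` by gluing
`K_{d_i}` along a `K_{d_i - 1}` for `i = 2, …, q`. -/
def IsSeqTree {V : Type u} [Fintype V] [DecidableEq V] (d : List ℕ) (H : SimpleGraph V) : Prop :=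
  (∀ k ∈ d, 0 < k) ∧ d.Pairwise (fun a b => b ≤ a) ∧ GluedCliques d Finset.univ H

/-! Independent sets of `G` are cliques of `Gᶜ`, so the clique complex of the glued graph has to be
studied. Gluing on a clique `T` adds a full simplex that meets the old complex in a simplex on `|T|
- 1` vertices (`cliquesIn_glue`, `cliquesIn_inter_Iic`). With `n` vertices in all, the face ring of
a simplex on `T` is `R` modulo the `n - |T|` variables outside `T`, and its projective dimension is
`n - |T|`.

Let `e` be the last, hence smallest, clique size. In the Mayer–Vietoris sequence `0 → R/(I ⊓ J) →
R/I × R/J → R/(I ⊔ J) → 0` the right-hand term has dimension at most `n - e + 1`, so induction on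
the gluing bounds the left-hand one by `n - e`. At the last gluing the right-hand term has dimension
exactly `n - e + 1` and the middle one at most `n - e`, so the left-hand term cannot drop below `n -
e`.

The maximal degree is also `n - e`: every vertex lies in a clique of `Gᶜ` of size at least `e`, and
a vertex new in the last clique has no other neighbours in `Gᶜ`. -/

open CategoryTheory Abelian MvPolynomial

/-! ### Exact sequences of cyclic modules -/

section QuotientSequences

variable {R : Type u} [CommRing R]

/-- The Mayer–Vietoris complex `R/(I ⊓ J) → R/I × R/J → R/(I ⊔ J)`. -/
noncomputable def Ideal.mayerVietoris (I J : Ideal R) : ShortComplex (ModuleCat.{u} R) :=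
  ModuleCat.shortComplexOfCompEqZero
    (((I ⊓ J).mapQ I LinearMap.id inf_le_left).prod ((I ⊓ J).mapQ J LinearMap.id inf_le_right))
    ((I.mapQ (I ⊔ J) LinearMap.id le_sup_left).coprod
      (-(J.mapQ (I ⊔ J) LinearMap.id le_sup_right))) (by
      ext; simp)

lemma Ideal.mayerVietoris_shortExact (I J : Ideal R) : (I.mayerVietoris J).ShortExact where
  exact := by
    refine ModuleCat.shortComplex_exact _ ?_
    rintro ⟨a, b⟩
    obtain ⟨a, rfl⟩ := Submodule.mkQ_surjective I a
    obtain ⟨b, rfl⟩ := Submodule.mkQ_surjective J b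
    constructor
    · intro h
      replace h : (I ⊔ J).mkQ a + -(I ⊔ J).mkQ b = 0 := h
      rw [← sub_eq_add_neg, ← map_sub, Submodule.mkQ_apply, Submodule.Quotient.mk_eq_zero,
        Submodule.mem_sup] at h
      obtain ⟨i, hi, j, hj, hij⟩ := h
      refine ⟨(I ⊓ J).mkQ (a - i), Prod.ext ?_ ?_⟩
      · change I.mkQ (a - i) = I.mkQ a
        rw [← sub_eq_zero, ← map_sub, Submodule.mkQ_apply, Submodule.Quotient.mk_eq_zero]
        simpa using hi
      · change J.mkQ (a - i) = J.mkQ b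
        rw [← sub_eq_zero, ← map_sub, Submodule.mkQ_apply, Submodule.Quotient.mk_eq_zero]
        convert hj using 1
        linear_combination -hij
    · rintro ⟨c, hc⟩
      rw [← hc]
      exact (ModuleCat.hom_ext_iff.mp (I.mayerVietoris J).zero |> fun h => LinearMap.congr_fun h c)
  mono_f := by
    rw [ModuleCat.mono_iff_injective, injective_iff_map_eq_zero]
    intro c hc
    obtain ⟨c, rfl⟩ := Submodule.mkQ_surjective (I ⊓ J) c
    replace hc : (I.mkQ c, J.mkQ c) = 0 := hc
    simp only [Prod.mk_eq_zero, Submodule.mkQ_apply, Submodule.Quotient.mk_eq_zero] at hc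
    exact (Submodule.Quotient.mk_eq_zero _).mpr hc
  epi_g := by
    rw [ModuleCat.epi_iff_surjective]
    intro c
    obtain ⟨c, rfl⟩ := Submodule.mkQ_surjective (I ⊔ J) c
    refine ⟨(I.mkQ c, 0), ?_⟩
    change (I ⊔ J).mkQ c + -0 = _
    simp

lemma ModuleCat.hasProjectiveDimensionLT_prod (M N : Type u) [AddCommGroup M] [Module R M]
    [AddCommGroup N] [Module R N] (n : ℕ) (hM : HasProjectiveDimensionLT (ModuleCat.of R M) n)
    (hN : HasProjectiveDimensionLT (ModuleCat.of R N) n) :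
    HasProjectiveDimensionLT (ModuleCat.of R (M × N)) n :=
  hasProjectiveDimensionLT_of_iso (ModuleCat.biprodIsoProd (.of R M) (.of R N)) n

/-- The complex `R/I → R/I → R/(I ⊔ (x))` whose first map is multiplication by `x`. -/
noncomputable def Ideal.mulQuotient (I : Ideal R) (x : R) : ShortComplex (ModuleCat.{u} R) :=
  ModuleCat.shortComplexOfCompEqZero (LinearMap.lsmul R (R ⧸ I) x)
    (I.mapQ (I ⊔ Ideal.span {x}) LinearMap.id le_sup_left) (by
      refine Submodule.linearMap_qext _ (LinearMap.ext fun a => ?_)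
      exact (Submodule.Quotient.mk_eq_zero _).mpr (Ideal.mem_sup_right
        (Ideal.mul_mem_right a _ (Ideal.mem_span_singleton_self x))))

lemma Ideal.mulQuotient_shortExact (I : Ideal R) (x : R) (hx : ∀ p, x * p ∈ I → p ∈ I) :
    (I.mulQuotient x).ShortExact where
  exact := by
    refine ModuleCat.shortComplex_exact _ ?_
    intro a
    constructor
    · intro h
      obtain ⟨a, rfl⟩ := Submodule.mkQ_surjective I a
      replace h : (I ⊔ Ideal.span {x}).mkQ a = 0 := h
      rw [Submodule.mkQ_apply, Submodule.Quotient.mk_eq_zero, Submodule.mem_sup] at h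
      obtain ⟨i, hi, j, hj, hij⟩ := h
      obtain ⟨c, rfl⟩ := Ideal.mem_span_singleton.mp hj
      refine ⟨I.mkQ c, ?_⟩
      change I.mkQ (x * c) = I.mkQ a
      rw [← sub_eq_zero, ← map_sub, Submodule.mkQ_apply, Submodule.Quotient.mk_eq_zero]
      convert I.neg_mem hi using 1
      linear_combination hij
    · rintro ⟨c, hc⟩
      rw [← hc]
      exact (ModuleCat.hom_ext_iff.mp (I.mulQuotient x).zero |> fun h => LinearMap.congr_fun h c)
  mono_f := by
    rw [ModuleCat.mono_iff_injective, injective_iff_map_eq_zero]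
    intro c hc
    obtain ⟨c, rfl⟩ := Submodule.mkQ_surjective I c
    replace hc : I.mkQ (x * c) = 0 := hc
    rw [Submodule.mkQ_apply, Submodule.Quotient.mk_eq_zero] at hc
    exact (Submodule.Quotient.mk_eq_zero _).mpr (hx c hc)
  epi_g := by
    rw [ModuleCat.epi_iff_surjective]
    intro c
    obtain ⟨c, rfl⟩ := Submodule.mkQ_surjective (I ⊔ Ideal.span {x}) c
    exact ⟨I.mkQ c, rfl⟩

lemma CategoryTheory.Abelian.Ext.mk₀_smul_id_comp_eq_zero {M N : ModuleCat.{u} R} (x : R)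
    (hN : x ∈ Module.annihilator R N) {n : ℕ} (y : Ext M N n) :
    (Ext.mk₀ (x • 𝟙 M)).comp y (zero_add n) = 0 := by
  have hN' : x • 𝟙 N = 0 := by
    simp [← ModuleCat.lsmul_eq_smul_id, Module.mem_annihilator_iff_lsmul_eq_zero.mp hN]
  rw [Ext.mk₀_smul, Ext.smul_comp, Ext.mk₀_id_comp, Ext.smul_eq_comp_mk₀, hN', Ext.mk₀_zero,
    Ext.comp_zero]

/-- Multiplication by `x` induces zero on `Ext` into `N`, so the connecting map out of degree `n` is
injective and carries a nonzero class to a nonzero class. -/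
lemma Ideal.ext_quotient_sup_span_nontrivial (I : Ideal R) (x : R) (hx : ∀ p, x * p ∈ I → p ∈ I)
    (N : ModuleCat.{u} R) (hN : x ∈ Module.annihilator R N) (n : ℕ)
    (h : Nontrivial (Ext (ModuleCat.of R (R ⧸ I)) N n)) :
    Nontrivial (Ext (ModuleCat.of R (R ⧸ (I ⊔ Ideal.span {x}))) N (n + 1)) := by
  obtain ⟨e, he⟩ := exists_ne (0 : Ext (ModuleCat.of R (R ⧸ I)) N n)
  have hS := I.mulQuotient_shortExact x hx
  by_contra hcon
  rw [not_nontrivial_iff_subsingleton] at hcon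
  have hzero : hS.extClass.comp (Y := (I.mulQuotient x).X₁) e (add_comm 1 n) = 0 :=
    hcon.elim _ _
  obtain ⟨y, hy⟩ := Ext.contravariant_sequence_exact₁ hS N e (add_comm 1 n) hzero
  exact he (hy.symm.trans (Ext.mk₀_smul_id_comp_eq_zero x hN y))

end QuotientSequences

/-! ### Face ideals and the face rings of simplices -/

section FaceIdeal

variable (K : Type v) [Field K] {V : Type u}

/-- The ideal generated by the monomials whose support is not in `Δ`. -/
noncomputable def faceIdeal (Δ : Set (Finset V)) : Ideal (MvPolynomial V K) :=
  Ideal.span ((fun m => monomial m (1 : K)) '' {m | m.support ∉ Δ})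

variable {K}

/-- Non-faces are closed under enlargement, so a multiple of a generator is again a generator.
Membership thus becomes a condition on single monomials, which turns unions of complexes into
intersections of ideals. -/
lemma mem_faceIdeal {Δ : Set (Finset V)} (hΔ : IsLowerSet Δ) {p : MvPolynomial V K} :
    p ∈ faceIdeal K Δ ↔ ∀ m ∈ p.support, m.support ∉ Δ := by
  rw [faceIdeal, mem_ideal_span_monomial_image]
  refine forall₂_congr fun m _ => ⟨?_, fun h => ⟨m, h, le_rfl⟩⟩
  rintro ⟨s, hs, hsm⟩ hm
  exact hs (hΔ (Finsupp.support_mono hsm) hm)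

lemma faceIdeal_inter (Δ Γ : Set (Finset V)) :
    faceIdeal K (Δ ∩ Γ) = faceIdeal K Δ ⊔ faceIdeal K Γ := by
  rw [faceIdeal, faceIdeal, faceIdeal, ← Ideal.span_union, ← Set.image_union]
  congr 2
  ext m
  simp only [Set.mem_inter_iff, Set.mem_ofPred_eq, Set.mem_union]
  tauto

lemma faceIdeal_union {Δ Γ : Set (Finset V)} (hΔ : IsLowerSet Δ) (hΓ : IsLowerSet Γ) :
    faceIdeal K (Δ ∪ Γ) = faceIdeal K Δ ⊓ faceIdeal K Γ := by
  ext p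
  rw [Submodule.mem_inf, mem_faceIdeal (hΔ.union hΓ), mem_faceIdeal hΔ, mem_faceIdeal hΓ,
    ← forall₂_and]
  simp only [Set.mem_union, not_or]

lemma X_mul_mem_faceIdeal_Iic [DecidableEq V] {v : V} {T : Finset V} (hv : v ∈ T)
    (p : MvPolynomial V K) (hp : X v * p ∈ faceIdeal K (Set.Iic T)) :
    p ∈ faceIdeal K (Set.Iic T) := by
  rw [mem_faceIdeal (isLowerSet_Iic T)] at hp ⊢
  intro m hm hmT
  refine hp (Finsupp.single v 1 + m) ?_ ?_
  · rw [support_X_mul]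
    exact Finset.mem_map_of_mem _ hm
  · exact Finsupp.support_add.trans (Finset.union_subset
      (Finsupp.support_single_subset.trans (Finset.singleton_subset_iff.mpr hv)) hmT)

lemma faceIdeal_Iic_insert_sup [DecidableEq V] {v : V} {T : Finset V} (hv : v ∉ T) :
    faceIdeal K (Set.Iic (insert v T)) ⊔ Ideal.span {X v} = faceIdeal K (Set.Iic T) := by
  refine le_antisymm (sup_le (Ideal.span_mono (Set.image_mono ?_)) ?_) (Ideal.span_le.mpr ?_)
  · exact fun m hm hmT => hm (hmT.trans (Finset.subset_insert v T))
  · rw [Ideal.span_le, Set.singleton_subset_iff]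
    refine Ideal.subset_span ⟨Finsupp.single v 1, fun h => hv ?_, rfl⟩
    rw [Finsupp.support_single v one_ne_zero] at h
    exact Finset.singleton_subset_iff.mp h
  · rintro _ ⟨m, hm, rfl⟩
    by_cases hmv : v ∈ m.support
    · refine Ideal.mem_sup_right (Ideal.mem_span_singleton.mpr ?_)
      rw [X, monomial_dvd_monomial]
      exact ⟨Or.inr (Finsupp.single_le_iff.mpr
        (Nat.one_le_iff_ne_zero.mpr (Finsupp.mem_support_iff.mp hmv))), one_dvd _⟩
    · refine Ideal.mem_sup_left (Ideal.subset_span ⟨m, fun h => hm ?_, rfl⟩)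
      exact fun w hw => (Finset.mem_insert.mp (h hw)).resolve_left (fun e => hmv (e ▸ hw))

lemma faceIdeal_Iic_univ [Fintype V] : faceIdeal K (Set.Iic (Finset.univ : Finset V)) = ⊥ := by
  simp [faceIdeal]

lemma faceIdeal_Iic_ne_top (T : Finset V) : faceIdeal K (Set.Iic T) ≠ ⊤ := by
  rw [Ne, Ideal.eq_top_iff_one, mem_faceIdeal (isLowerSet_Iic T)]
  intro h
  exact h 0 (by simp) (by simp)

lemma X_mem_faceIdeal_Iic_empty (v : V) : X v ∈ faceIdeal K (Set.Iic (∅ : Finset V)) := by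
  refine Ideal.subset_span ⟨Finsupp.single v 1, ?_, rfl⟩
  simp

variable (K) in
/-- The quotient by the face ideal, as an object of the category of modules. -/
noncomputable abbrev faceModule (Δ : Set (Finset V)) : ModuleCat.{max u v} (MvPolynomial V K) :=
  ModuleCat.of (MvPolynomial V K) (MvPolynomial V K ⧸ faceIdeal K Δ)

/-- The ideal is generated by the variables in `U`. Each is a nonzerodivisor modulo the previous
ones, and killing it raises the bound by one. -/
lemma hasProjectiveDimensionLE_faceModule_Iic [Fintype V] [DecidableEq V] (U : Finset V) :
    HasProjectiveDimensionLE (faceModule K (Set.Iic Uᶜ)) U.card := by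
  induction U using Finset.induction_on with
  | empty =>
    have : Module.Free (MvPolynomial V K) (MvPolynomial V K ⧸ faceIdeal K (Set.Iic (∅ : Finset V)ᶜ)) :=
      Module.Free.of_equiv (Submodule.quotEquivOfEqBot _
        (by rw [Finset.compl_empty, faceIdeal_Iic_univ])).symm
    have : Projective (faceModule K (Set.Iic (∅ : Finset V)ᶜ)) :=
      ModuleCat.projective_of_free (Module.Free.chooseBasis (MvPolynomial V K) _)
    exact (projective_iff_hasProjectiveDimensionLE_zero _).mp this
  | insert v U hv ih =>
    have hU : Uᶜ = insert v (insert v U)ᶜ := by ext w; by_cases h : w = v <;> simp [h, hv]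
    have hv' : v ∉ (insert v U)ᶜ := by simp
    have hS := Ideal.mulQuotient_shortExact (faceIdeal K (Set.Iic Uᶜ)) (X v)
      (X_mul_mem_faceIdeal_Iic (by simpa using hv))
    have h3 := hS.hasProjectiveDimensionLT_X₃ _ ih
      (hasProjectiveDimensionLT_of_ge (faceModule K (Set.Iic Uᶜ)) (U.card + 1) _ (Nat.le_succ _))
    rw [Finset.card_insert_of_notMem hv]
    rw [faceModule, ← faceIdeal_Iic_insert_sup hv', ← hU]
    exact h3

/-- The target is the residue field at the origin. It is killed by every variable, so a nonzero map
from `R` climbs one `Ext` degree per variable; this makes the preceding bound sharp. -/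
lemma nontrivial_ext_faceModule_Iic [Fintype V] [DecidableEq V] (U : Finset V) :
    Nontrivial (Ext (faceModule K (Set.Iic Uᶜ)) (faceModule K (Set.Iic (∅ : Finset V))) U.card) := by
  induction U using Finset.induction_on with
  | empty =>
    have hne : (ModuleCat.ofHom (Submodule.mapQ _ _ LinearMap.id (Ideal.span_mono (Set.image_mono
        fun m hm hmT => hm (hmT.trans (Finset.empty_subset _))))) :
        faceModule K (Set.Iic (∅ : Finset V)ᶜ) ⟶ faceModule K (Set.Iic (∅ : Finset V))) ≠ 0 := by
      intro h
      have h1 := LinearMap.congr_fun (ModuleCat.hom_ext_iff.mp h)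
        (Submodule.Quotient.mk (1 : MvPolynomial V K))
      replace h1 : (Submodule.Quotient.mk (1 : MvPolynomial V K) :
        MvPolynomial V K ⧸ faceIdeal K (Set.Iic (∅ : Finset V))) = 0 := h1
      rw [Submodule.Quotient.mk_eq_zero] at h1
      exact faceIdeal_Iic_ne_top _ ((Ideal.eq_top_iff_one _).mpr h1)
    have := nontrivial_of_ne _ _ hne
    exact (Ext.homEquiv₀ (X := faceModule K (Set.Iic (∅ : Finset V)ᶜ))
      (Y := faceModule K (Set.Iic (∅ : Finset V)))).nontrivial
  | insert v U hv ih =>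
    have hU : Uᶜ = insert v (insert v U)ᶜ := by ext w; by_cases h : w = v <;> simp [h, hv]
    have hv' : v ∉ (insert v U)ᶜ := by simp
    have h3 := Ideal.ext_quotient_sup_span_nontrivial (faceIdeal K (Set.Iic Uᶜ)) (X v)
      (X_mul_mem_faceIdeal_Iic (by simpa using hv)) (faceModule K (Set.Iic (∅ : Finset V)))
      (by
        rw [Ideal.annihilator_quotient]
        exact X_mem_faceIdeal_Iic_empty v) U.card ih
    rw [Finset.card_insert_of_notMem hv]
    rw [faceModule, ← faceIdeal_Iic_insert_sup hv', ← hU]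
    exact h3

lemma hasProjectiveDimensionLT_faceModule_Iic_iff [Fintype V] [DecidableEq V] (T : Finset V)
    (n : ℕ) :
    HasProjectiveDimensionLT (faceModule K (Set.Iic T)) n ↔ Fintype.card V - T.card < n := by
  rw [← Finset.card_compl]
  have h1 := hasProjectiveDimensionLE_faceModule_Iic (K := K) Tᶜ
  have h2 := nontrivial_ext_faceModule_Iic (K := K) Tᶜ
  rw [compl_compl] at h1 h2
  refine ⟨fun h => ?_, fun h => hasProjectiveDimensionLT_of_ge (faceModule K (Set.Iic T)) (Tᶜ.card + 1) _ h⟩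
  by_contra! hn
  exact not_subsingleton _ (HasProjectiveDimensionLT.subsingleton (faceModule K (Set.Iic T)) n _ hn
    (faceModule K (Set.Iic (∅ : Finset V))))

lemma hasProjectiveDimensionLT_faceModule_union {Δ Γ : Set (Finset V)}
    (hΔ : IsLowerSet Δ) (hΓ : IsLowerSet Γ) (n : ℕ)
    (h₁ : HasProjectiveDimensionLT (faceModule K Δ) (n + 1))
    (h₂ : HasProjectiveDimensionLT (faceModule K Γ) (n + 1))
    (h₃ : HasProjectiveDimensionLT (faceModule K (Δ ∩ Γ)) (n + 2)) :
    HasProjectiveDimensionLT (faceModule K (Δ ∪ Γ)) (n + 1) := by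
  rw [faceModule, faceIdeal_inter] at h₃
  rw [faceModule, faceIdeal_union hΔ hΓ]
  exact (Ideal.mayerVietoris_shortExact _ _).hasProjectiveDimensionLT_X₁ (n + 1)
    (ModuleCat.hasProjectiveDimensionLT_prod _ _ _ h₁ h₂) h₃

lemma hasProjectiveDimensionLT_faceModule_inter {Δ Γ : Set (Finset V)}
    (hΔ : IsLowerSet Δ) (hΓ : IsLowerSet Γ) (n : ℕ)
    (h₁ : HasProjectiveDimensionLT (faceModule K Δ) (n + 1))
    (h₂ : HasProjectiveDimensionLT (faceModule K Γ) (n + 1))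
    (h₃ : HasProjectiveDimensionLT (faceModule K (Δ ∪ Γ)) n) :
    HasProjectiveDimensionLT (faceModule K (Δ ∩ Γ)) (n + 1) := by
  rw [faceModule, faceIdeal_union hΔ hΓ] at h₃
  rw [faceModule, faceIdeal_inter]
  exact (Ideal.mayerVietoris_shortExact _ _).hasProjectiveDimensionLT_X₃ n h₃
    (ModuleCat.hasProjectiveDimensionLT_prod _ _ _ h₁ h₂)

end FaceIdeal

/-! ### Clique complexes of glued cliques -/

section CliqueComplex

variable {V : Type u}

/-- The cliques of `H` that are contained in `S`. -/
def cliquesIn (S : Finset V) (H : SimpleGraph V) : Set (Finset V) :=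
  {F | F ⊆ S ∧ H.IsClique (F : Set V)}

lemma isLowerSet_cliquesIn (S : Finset V) (H : SimpleGraph V) : IsLowerSet (cliquesIn S H) :=
  fun _ _ hEF hF => ⟨hEF.trans hF.1, hF.2.subset (Finset.coe_subset.mpr hEF)⟩

lemma cliquesIn_completeOn (T : Finset V) : cliquesIn T (completeOn T) = Set.Iic T := by
  ext F
  exact ⟨fun h => h.1, fun h => ⟨h, fun a ha b hb hab => ⟨hab, h ha, h hb⟩⟩⟩

variable [DecidableEq V]

lemma GluedCliques.mem_of_adj {d : List ℕ} {S : Finset V} {H : SimpleGraph V}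
    (h : GluedCliques d S H) {a b : V} (hab : H.Adj a b) : a ∈ S := by
  induction h with
  | base T => exact hab.2.1
  | glue d S H T _ _ _ ih =>
    exact hab.elim (fun h => Finset.mem_union_left _ (ih h))
      (fun h => Finset.mem_union_right _ h.2.1)

lemma GluedCliques.ne_nil {d : List ℕ} {S : Finset V} {H : SimpleGraph V}
    (h : GluedCliques d S H) : d ≠ [] := by
  cases h <;> simp

lemma GluedCliques.exists_clique {d : List ℕ} {S : Finset V} {H : SimpleGraph V}
    (h : GluedCliques d S H) {a : V} (ha : a ∈ S) :
    ∃ T : Finset V, T.card ∈ d ∧ a ∈ T ∧ H.IsClique (T : Set V) := by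
  induction h with
  | base T => exact ⟨T, by simp, ha, fun a ha b hb hab => ⟨hab, ha, hb⟩⟩
  | glue d S H T _ _ _ ih =>
    by_cases haT : a ∈ T
    · exact ⟨T, by simp, haT, fun a ha b hb hab => Or.inr ⟨hab, ha, hb⟩⟩
    · obtain ⟨T', h1, h2, h3⟩ := ih ((Finset.mem_union.mp ha).resolve_right haT)
      exact ⟨T', List.mem_append_left _ h1, h2, h3.mono le_sup_left⟩

lemma GluedCliques.exists_adj_subset_last {d : List ℕ} {S : Finset V} {H : SimpleGraph V}
    (h : GluedCliques d S H) (hpos : ∀ k ∈ d, 0 < k) :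
    ∃ (T : Finset V) (a : V), d.getLast? = some T.card ∧ a ∈ T ∧ ∀ b, H.Adj a b → b ∈ T := by
  cases h with
  | base =>
    obtain ⟨a, ha⟩ := Finset.card_pos.mp (hpos S.card (by simp))
    exact ⟨S, a, by simp, ha, fun b hb => hb.2.2⟩
  | glue d S H T hH hclique hcard =>
    -- As `|S ∩ T| = |T| - 1`, the gluing adds a new vertex; all its edges lie in `T`.
    obtain ⟨a, haT, haS⟩ : ∃ a ∈ T, a ∉ S := by
      by_contra! hTS
      rw [Finset.inter_eq_right.mpr hTS] at hcard
      omega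
    exact ⟨T, a, by simp, haT, fun b hb => hb.elim (fun h => absurd (hH.mem_of_adj h) haS)
      (fun h => h.2.2)⟩

/-- A clique with a vertex outside `S` can only use the new edges there, so it lies in `T`. Inside
`S` the new edges join vertices of `S ∩ T`, which are already adjacent in `H`. -/
lemma cliquesIn_glue {S T : Finset V} {H : SimpleGraph V} (hH : ∀ a b, H.Adj a b → a ∈ S)
    (hclique : H.IsClique ((S ∩ T : Finset V) : Set V)) :
    cliquesIn (S ∪ T) (H ⊔ completeOn T) = cliquesIn S H ∪ Set.Iic T := by
  ext F
  constructor
  · rintro ⟨hF, hc⟩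
    by_cases hFS : F ⊆ S
    · refine Or.inl ⟨hFS, fun a ha b hb hab => (hc ha hb hab).elim id fun h => ?_⟩
      exact hclique (Finset.mem_inter.mpr ⟨hFS ha, h.2.1⟩) (Finset.mem_inter.mpr ⟨hFS hb, h.2.2⟩) hab
    · obtain ⟨a, ha, haS⟩ := Finset.not_subset.mp hFS
      refine Or.inr fun b hb => ?_
      rcases eq_or_ne a b with rfl | hab
      · exact (Finset.mem_union.mp (hF ha)).resolve_left haS
      · exact (hc ha hb hab).elim (fun h => absurd (hH a b h) haS) (fun h => h.2.2)
  · rintro (⟨hF, hc⟩ | hF)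
    · exact ⟨hF.trans Finset.subset_union_left, hc.mono le_sup_left⟩
    · exact ⟨hF.trans Finset.subset_union_right,
        fun a ha b hb hab => Or.inr ⟨hab, hF ha, hF hb⟩⟩

lemma cliquesIn_inter_Iic {S T : Finset V} {H : SimpleGraph V}
    (hclique : H.IsClique ((S ∩ T : Finset V) : Set V)) :
    cliquesIn S H ∩ Set.Iic T = Set.Iic (S ∩ T) := by
  ext F
  refine ⟨fun h => Finset.subset_inter h.1.1 h.2, fun h => ⟨⟨?_, ?_⟩, ?_⟩⟩
  · exact h.trans Finset.inter_subset_left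
  · exact hclique.subset (Finset.coe_subset.mpr h)
  · exact h.trans Finset.inter_subset_right

variable (K : Type v) [Field K] [Fintype V]

lemma GluedCliques.hasProjectiveDimensionLE {d : List ℕ} {S : Finset V} {H : SimpleGraph V}
    (h : GluedCliques d S H) (e : ℕ) (he : ∀ k ∈ d, e ≤ k) :
    HasProjectiveDimensionLE (faceModule K (cliquesIn S H)) (Fintype.card V - e) := by
  induction h with
  | base T =>
    rw [cliquesIn_completeOn, HasProjectiveDimensionLE, hasProjectiveDimensionLT_faceModule_Iic_iff]
    have := he T.card (by simp)
    omega
  | glue d S H T hH hclique hcard ih =>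
    have heT := he T.card (by simp)
    rw [cliquesIn_glue (fun a b => hH.mem_of_adj) hclique]
    refine hasProjectiveDimensionLT_faceModule_union (isLowerSet_cliquesIn S H) (isLowerSet_Iic T) _
      (ih fun k hk => he k (List.mem_append_left _ hk)) ?_ ?_
    · rw [hasProjectiveDimensionLT_faceModule_Iic_iff]
      omega
    -- The intersection has one vertex fewer than `T`; Mayer–Vietoris allows exactly this extra
    -- unit.
    · rw [cliquesIn_inter_Iic hclique, hasProjectiveDimensionLT_faceModule_Iic_iff]
      omega

lemma GluedCliques.not_hasProjectiveDimensionLT {d : List ℕ} {S : Finset V} {H : SimpleGraph V}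
    (h : GluedCliques d S H) (e : ℕ) (he : ∀ k ∈ d, e ≤ k) (hlast : d.getLast? = some e) :
    ¬ HasProjectiveDimensionLT (faceModule K (cliquesIn S H)) (Fintype.card V - e) := by
  cases h with
  | base =>
    obtain rfl : S.card = e := by simpa using hlast
    rw [cliquesIn_completeOn, hasProjectiveDimensionLT_faceModule_Iic_iff]
    exact lt_irrefl _
  | glue d S H T hH hclique hcard =>
    obtain rfl : T.card = e := by simpa using hlast
    rw [cliquesIn_glue (fun a b => hH.mem_of_adj) hclique]
    intro hlt
    -- A smaller dimension for the union would force at most `n - |T|` for the intersection, whose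
    -- dimension is `n - |T| + 1`.
    have := hasProjectiveDimensionLT_faceModule_inter (isLowerSet_cliquesIn S H)
      (isLowerSet_Iic T) _
      (hH.hasProjectiveDimensionLE K _ fun k hk => he k (List.mem_append_left _ hk))
      ((hasProjectiveDimensionLT_faceModule_Iic_iff T _).mpr (Nat.lt_succ_self _)) hlt
    rw [cliquesIn_inter_Iic hclique, hasProjectiveDimensionLT_faceModule_Iic_iff] at this
    have := T.card_le_univ
    omega

lemma stanleyReisnerIdeal_independenceComplex_eq (G : SimpleGraph V) :
    stanleyReisnerIdeal K (independenceComplex G) = faceIdeal K (cliquesIn Finset.univ Gᶜ) := by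
  have hmem (F : Finset V) : F ∈ cliquesIn Finset.univ Gᶜ ↔
      ¬ (F.Nonempty ∧ F ∉ (independenceComplex G).faces) := by
    change F ⊆ Finset.univ ∧ Gᶜ.IsClique _ ↔ ¬ (F.Nonempty ∧ ¬ (F.Nonempty ∧ G.IsIndepSet _))
    rw [SimpleGraph.isClique_compl]
    rcases F.eq_empty_or_nonempty with rfl | hF
    · simp
    · simp [hF]
  have hprod (F : Finset V) : (∏ x ∈ F, X x : MvPolynomial V K) =
      monomial (∑ x ∈ F, Finsupp.single x 1) 1 := (monomial_sum_one F _).symm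
  have hsupp (F : Finset V) : (∑ x ∈ F, Finsupp.single x 1 : V →₀ ℕ).support = F := by
    ext a
    simp [Finsupp.finsetSum_apply, Finsupp.single_apply]
  refine le_antisymm (Ideal.span_le.mpr ?_) (Ideal.span_le.mpr ?_)
  · rintro _ ⟨F, hF, hFG, rfl⟩
    refine Ideal.subset_span ⟨∑ x ∈ F, Finsupp.single x 1, ?_, (hprod F).symm⟩
    rw [Set.mem_ofPred_eq, hsupp, hmem]
    exact not_not.mpr ⟨hF, hFG⟩
  · rintro _ ⟨m, hm, rfl⟩
    rw [Set.mem_ofPred_eq, hmem, not_not] at hm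
    -- The squarefree monomial on the support of `m` divides `m`.
    refine Ideal.mem_of_dvd _ ?_ (Ideal.subset_span ⟨m.support, hm.1, hm.2, rfl⟩)
    rw [hprod, monomial_dvd_monomial]
    refine ⟨Or.inr fun a => ?_, one_dvd _⟩
    simp only [Finsupp.finsetSum_apply, Finsupp.single_apply, Finset.sum_ite_eq',
      Finsupp.mem_support_iff]
    split_ifs <;> omega

end CliqueComplex

/-! ### Maximal degree and conclusion -/

lemma SimpleGraph.maxDegree_eq_of_gluedCliques_compl {V : Type u} [Fintype V] [DecidableEq V]
    (G : SimpleGraph V) [DecidableRel G.Adj] {d : List ℕ}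
    (h : GluedCliques d Finset.univ Gᶜ) (hpos : ∀ k ∈ d, 0 < k) {e : ℕ} (he : ∀ k ∈ d, e ≤ k)
    (hlast : d.getLast? = some e) : G.maxDegree = Fintype.card V - e := by
  refine le_antisymm (G.maxDegree_le_of_forall_degree_le _ fun a => ?_) ?_
  · obtain ⟨T, hTd, haT, hT⟩ := h.exists_clique (Finset.mem_univ a)
    have hsub : G.neighborFinset a ⊆ Tᶜ := fun b hb => by
      rw [G.mem_neighborFinset] at hb
      exact Finset.mem_compl.mpr fun hbT => (hT haT hbT hb.ne).2 hb
    have := Finset.card_le_card hsub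
    rw [G.card_neighborFinset_eq_degree, Finset.card_compl] at this
    have := he _ hTd
    omega
  · obtain ⟨T, a, hT, haT, ha⟩ := h.exists_adj_subset_last hpos
    obtain rfl : T.card = e := Option.some.inj (hT.symm.trans hlast)
    refine le_trans ?_ (G.degree_le_maxDegree a)
    rw [← Finset.card_compl, ← G.card_neighborFinset_eq_degree]
    refine Finset.card_le_card fun b hb => ?_
    rw [Finset.mem_compl] at hb
    rw [G.mem_neighborFinset]
    by_contra hab
    exact hb (ha b ⟨fun h => hb (h ▸ haT), hab⟩)

theorem mainTheorem4 {V : Type u} [Fintype V] [DecidableEq V] (K : Type v) [Field K]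
    (G : SimpleGraph V) [DecidableRel G.Adj] (hG : G.Connected)
    (d : List ℕ) (hd : IsSeqTree d Gᶜ) :
    CategoryTheory.projectiveDimension
      (ModuleCat.of (MvPolynomial V K) (StanleyReisnerRing K (independenceComplex G))) =
        ((G.maxDegree : ℕ∞) : WithBot ℕ∞) := by
  obtain ⟨hpos, hsort, hglue⟩ := hd
  have hlast : d.getLast? = some (d.getLast hglue.ne_nil) := List.getLast?_eq_getLast_of_ne_nil _
  have hmin : ∀ k ∈ d, d.getLast hglue.ne_nil ≤ k := fun k hk => by
    rw [← List.dropLast_append_getLast hglue.ne_nil] at hsort hk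
    rw [List.pairwise_append] at hsort
    rcases List.mem_append.mp hk with hk | hk
    · exact hsort.2.2 k hk _ (List.mem_singleton_self _)
    · exact (List.mem_singleton.mp hk).ge
  change projectiveDimension (ModuleCat.of (MvPolynomial V K)
    (MvPolynomial V K ⧸ stanleyReisnerIdeal K (independenceComplex G))) = _
  rw [stanleyReisnerIdeal_independenceComplex_eq,
    G.maxDegree_eq_of_gluedCliques_compl hglue hpos hmin hlast]
  exact le_antisymm
    ((projectiveDimension_le_iff _ _).mpr (hglue.hasProjectiveDimensionLE K _ hmin))
    ((projectiveDimension_ge_iff _ _).mpr (hglue.not_hasProjectiveDimensionLT K _ hmin hlast))
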